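/- Let $\varphi_0,\varphi_1,\dots$ be a standard enumeration of the computable partial functions from $\mathbb{N}$ to $\mathbb{N}$, and let $\mathcal{K}=\{e\in\mathbb{N} : \varphi_e(e)\text{ is defined}\}$. For $n\in\mathbb{N}$ and recursively enumerable sets $A,B\subseteq\mathbb{N}$, write $A\leq_{n\text{-}d}B$ if there is a computable map $f$ from $\mathbb{N}$ to the finite subsets of $\mathbb{N}$ such that for every $e\in\mathbb{N}$ we have $|f(e)|\leq n$, and $e\in A$ if and only if $f(e)\cap B\neq\emptyset$. A recursively enumerable set $A$ is called $n$-$d$-complete if there is a computable map $f$ from $\mathbb{N}$ to the finite subsets of $\mathbb{N}$ such that for every $e\in\mathbb{N}$ we have $|f(e)|\leq n$, and $e\in\mathcal{K}$ if and only if $f(e)\cap A\neq\emptyset$. Corollary. For every $n\geq 2$, the relation $\leq_{n\text{-}d}$ on the recursively enumerable sets is not transitive. More precisely, for every $n\geq 2$ there are recursively enumerable sets $A,B\subseteq\mathbb{N}$ such that $A$ is $2n$-$d$-complete but not $n$-$d$-complete, $\mathcal{K}\leq_{n\text{-}d}B$ and $B\leq_{n\text{-}d}A$, but $\mathcal{K}\not\leq_{n\text{-}d}A$.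 -/

import Mathlib

namespace ND

/-- A set of natural numbers is recursively enumerable. -/
def IsRE (A : Set ℕ) : Prop := REPred fun x : ℕ => x ∈ A

/-- The standard enumeration `φ 0, φ 1, …` of all computable partial functions `ℕ ⇀ ℕ`. -/
def φ (e : ℕ) : ℕ →. ℕ := (Denumerable.ofNat Nat.Partrec.Code e).eval

/-- The halting set: all `e` such that `φ e` is defined at `e`. -/
def K : Set ℕ := {e | (φ e e).Dom}

/-- `A` `n`-`d`-reduces to `B` via `f`. Here `f : ℕ → Finset ℕ` is computable in the sense that the
map on natural numbers obtained from the standard coding of finite sets of naturals is. -/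
def ReducesVia (n : ℕ) (A B : Set ℕ) (f : ℕ → Finset ℕ) : Prop :=
  Computable f ∧ (∀ e, (f e).card ≤ n) ∧ ∀ e, e ∈ A ↔ ∃ z ∈ f e, z ∈ B

/-- The relation `A ≤_{n-d} B`; it is considered for recursively enumerable `A` and `B`. -/
def Reduces (n : ℕ) (A B : Set ℕ) : Prop := ∃ f, ReducesVia n A B f

/-- The relation `≤_{n-d}` on the recursively enumerable sets. -/
def reduction (n : ℕ) (A B : {S : Set ℕ // IsRE S}) : Prop := Reduces n A.1 B.1

/-- `A` is `d`-complete witnessed by `f`. -/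
def DCompleteVia (A : Set ℕ) (f : ℕ → Finset ℕ) : Prop :=
  IsRE A ∧ Computable f ∧ ∀ e, e ∈ K ↔ ∃ z ∈ f e, z ∈ A

/-- `A` is `n`-`d`-complete. -/
def NDComplete (n : ℕ) (A : Set ℕ) : Prop :=
  ∃ f, DCompleteVia A f ∧ ∀ e, (f e).card ≤ n

end ND

namespace ND

open Encodable Denumerable
open Nat.Partrec (Code)

/-! ### Computability of the coding of finite sets -/

/-! Split the naturals into blocks of `2 * n` consecutive numbers. When e enters K, all numbers of
block e not restrained at that stage enter A; B collects the half-blocks that meet A. As long as at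
most n numbers per block are restrained, K reduces to A by whole blocks, and to B by two
half-blocks. If K reduced to A with n queries, so would every r.e. set; a finite-injury construction
of an r.e. set C refutes this. Against f, choose x ≠ y and the petal f(x) \ f(y), of size at most n.
If the petal has already met A, keep x out of C. Otherwise put x into C and restrain the petal: f(x)
can then meet A only inside f(y), yet y stays out of C (`not_reduces_setC`). By pigeonhole some
petal avoids the blocks of the finitely many petals of higher priority. So petals active together
never share a block (`petal_disjoint_blocks`), which gives the bound n. -/

theorem foldl_raise' (l : List ℕ) : ∀ (acc : List ℕ) (n : ℕ),
    (l.foldl (fun (p : List ℕ × ℕ) m => (p.1 ++ [m + p.2], m + p.2 + 1)) (acc, n)).1 =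
      acc ++ raise' l n := by
  induction l with
  | nil => intro acc n; simp [raise']
  | cons m l ih => intro acc n; simp [raise', ih]

/-- The increasing list of the elements of the finite set with code `y`. -/
def enumList (y : ℕ) : List ℕ := raise' (ofNat (List ℕ) y) 0

theorem primrec_raise' : Primrec fun l : List ℕ => raise' l 0 := by
  have h : Primrec fun l : List ℕ =>
      (l.foldl (fun (p : List ℕ × ℕ) m => (p.1 ++ [m + p.2], m + p.2 + 1)) ([], 0)).1 := by
    refine (Primrec.list_foldl (f := fun l : List ℕ => l) (g := fun _ => (([] : List ℕ), 0))
      (h := fun _ (q : (List ℕ × ℕ) × ℕ) => (q.1.1 ++ [q.2 + q.1.2], q.2 + q.1.2 + 1))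
      Primrec.id (Primrec.const ([], 0)) ?_ : Primrec _) |> Primrec.fst.comp
    have h1 : Primrec fun q : List ℕ × (List ℕ × ℕ) × ℕ => q.2.2 + q.2.1.2 :=
      Primrec.nat_add.comp (Primrec.snd.comp Primrec.snd)
        (Primrec.snd.comp (Primrec.fst.comp Primrec.snd))
    exact Primrec.pair
      (Primrec.list_concat.comp (Primrec.fst.comp (Primrec.fst.comp Primrec.snd)) h1)
      (Primrec.succ.comp h1)
  exact h.of_eq fun l => by rw [foldl_raise']; rfl

theorem primrec_enumList : Primrec enumList :=
  primrec_raise'.comp (Primrec.ofNat (List ℕ))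

theorem mem_enumList {y z : ℕ} : z ∈ enumList y ↔ z ∈ ofNat (Finset ℕ) y := by
  have : ofNat (Finset ℕ) y = Finset.map (eqv ℕ).symm.toEmbedding (raise'Finset (ofNat (List ℕ) y) 0) := rfl
  rw [this]
  simp only [Finset.mem_map_equiv, Equiv.symm_symm]
  rfl

theorem mem_enumList_encode {s : Finset ℕ} {z : ℕ} : z ∈ enumList (Primcodable.toEncodable.encode s) ↔ z ∈ s := by
  rw [mem_enumList]; exact iff_of_eq (congrArg (z ∈ ·) (ofNat_encode s))

theorem length_enumList_encode (s : Finset ℕ) : (enumList (Primcodable.toEncodable.encode s)).length = s.card := by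
  have hn : (enumList (Primcodable.toEncodable.encode s)).Nodup := (raise'_sorted _ _).nodup
  rw [← List.toFinset_card_of_nodup hn]
  congr 1
  ext z
  simp [mem_enumList_encode]

/-- After its first entry the list coding a finite set records gaps minus one, so an interval is its
left end followed by zeros. -/
theorem raise'_replicate (k : ℕ) : ∀ (m a z : ℕ),
    z ∈ raise' (m :: List.replicate k 0) a ↔ m + a ≤ z ∧ z < m + a + (k + 1) := by
  induction k with
  | zero => intro m a z; simp [raise']; omega
  | succ k ih =>
    intro m a z
    rw [List.replicate_succ, raise', List.mem_cons, ih]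
    omega

theorem computable_Ico_mul (k : ℕ) (hk : 0 < k) :
    Computable fun x : ℕ => Finset.Ico (k * x) (k * x + k) := by
  have h : Computable fun x : ℕ =>
      ofNat (Finset ℕ) (encode (k * x :: List.replicate (k - 1) 0)) := by
    refine (Computable.ofNat (Finset ℕ)).comp (Computable.encode.comp ?_)
    exact (Primrec.list_cons.comp (Primrec.nat_mul.comp (Primrec.const k) Primrec.id)
      (Primrec.const _)).to_comp
  refine h.of_eq fun x => ?_
  ext z
  rw [← mem_enumList, enumList, ofNat_encode, raise'_replicate, Finset.mem_Ico]
  omega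

/-! ### Recursively enumerable sets -/

theorem rePred_exists {p : ℕ → ℕ → Prop} (hp : PrimrecRel p) : REPred fun x => ∃ k, p x k := by
  obtain ⟨hd, hp⟩ := hp
  have (x k : ℕ) : Decidable (p x k) := hd (x, k)
  have h : Partrec fun x => Nat.rfind fun k => Part.some (decide (p x k)) :=
    Partrec.rfind (Computable.partrec (hp.to_comp.of_eq fun _ => by simp))
  refine h.dom_re.of_eq fun x => ?_
  refine Nat.rfind_dom.trans ?_
  simp

theorem K_mem {e : ℕ} : e ∈ K ↔ ∃ t, (Code.evaln t (ofNat Code e) e).isSome := by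
  simp only [K, φ, Set.mem_ofPred_eq, Part.dom_iff_mem, Code.evaln_complete, Option.isSome_iff_exists,
    Option.mem_def]
  exact exists_comm

theorem isRE_K : IsRE K := by
  have h : Partrec fun e : ℕ => Code.eval (ofNat Code e) e :=
    Code.eval_part.comp (Computable.ofNat Code) Computable.id
  exact h.dom_re

/-- Every recursively enumerable set is many-one reducible to the halting set. -/
theorem IsRE.exists_reduction_K {C : Set ℕ} (hC : IsRE C) :
    ∃ h : ℕ → ℕ, Computable h ∧ ∀ x, x ∈ C ↔ h x ∈ K := by
  -- This program ignores the second component, so fixing the first to x gives a program that halts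
  -- on its own index exactly when x ∈ C.
  have h1 : Partrec fun p : ℕ => (Part.assert (p.unpair.1 ∈ C) fun _ => Part.some ()).map
      fun _ => (0 : ℕ) :=
    (Partrec.comp (f := fun a : ℕ => Part.assert (a ∈ C) fun _ => Part.some ()) hC
      (Computable.fst.comp Computable.unpair)).map (Computable.const 0).to₂
  obtain ⟨d, hd⟩ := Code.exists_code.1 (Partrec.nat_iff.1 h1)
  refine ⟨fun x => encode (Code.curry d x), Computable.encode.comp
    (Code.primrec₂_curry.comp (Primrec.const d) Primrec.id).to_comp, fun x => ?_⟩
  simp [K, φ, hd, Part.assert]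

/-! ### Primitive recursive predicates -/

theorem primrecRel_mem : PrimrecRel fun (a : ℕ) (l : List ℕ) => a ∈ l := by
  have h : PrimrecRel fun (l : List ℕ) (a : ℕ) => ∃ b ∈ l, b = a :=
    PrimrecRel.exists_mem_list Primrec.eq
  exact (h.comp Primrec.snd Primrec.fst).of_eq fun _ => by simp

theorem primrecPred_isSome {α : Type*} [Primcodable α] {f : α → Option ℕ} (hf : Primrec f) :
    PrimrecPred fun a => (f a).isSome = true :=
  Primrec.eq.comp (Primrec.option_isSome.comp hf) (Primrec.const true)

/-! ### The construction -/

/-- The result, if any, of running for `t` steps the program given by the column of `x` on `x`. -/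
def out (t x : ℕ) : Option ℕ := Code.evaln t (ofNat Code x.unpair.1) x

/-- The elements of the finite set coded by `out t x`. -/
def outList (t x : ℕ) : List ℕ := enumList ((out t x).getD 0)

/-- The first witness of a certificate. -/
def wit₁ (c : ℕ) : ℕ := c.unpair.1

/-- The second witness of a certificate. -/
def wit₂ (c : ℕ) : ℕ := c.unpair.2.unpair.1

/-- The number of steps allowed by a certificate. -/
def steps (c : ℕ) : ℕ := c.unpair.2.unpair.2

/-- The index of the requirement served by a certificate; a smaller index has higher priority. -/
def index (c : ℕ) : ℕ := (wit₁ c).unpair.1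

/-- The elements that an active certificate keeps out of `setA`. -/
def petal (c : ℕ) : List ℕ :=
  (outList (steps c) (wit₁ c)).filter (· ∉ outList (steps c) (wit₂ c))

/-- The certificate `c` has distinct witnesses in the same column whose computations halt. -/
def Halts (n c : ℕ) : Prop :=
  (out (steps c) (wit₁ c)).isSome ∧ (out (steps c) (wit₂ c)).isSome ∧
    (wit₂ c).unpair.1 = index c ∧ wit₁ c ≠ wit₂ c ∧ (outList (steps c) (wit₁ c)).length ≤ n

/-- The certificate `c` may act while `d` is active. -/
def Compatible (n d c : ℕ) : Prop :=
  index d ≠ index c ∧ (index c ≤ index d ∨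
    (d < wit₁ c ∧ d < wit₂ c ∧ ∀ w ∈ petal d, ∀ z ∈ petal c, z / (2 * n) ≠ w / (2 * n)))

/-- The certificate `c` may act while those in the list `L` are active. -/
def MayAct (n c : ℕ) (L : List ℕ) : Prop := Halts n c ∧ ∀ d ∈ L, Compatible n d c

open Classical in
/-- The certificates that are active before stage `s`. -/
noncomputable def active (n : ℕ) : ℕ → List ℕ
  | 0 => []
  | c + 1 => if MayAct n c (active n c) then c :: (active n c).filter (index · < index c)
      else active n c

/-- The certificate `c` acts, at stage `c`. -/
def Acts (n c : ℕ) : Prop := MayAct n c (active n c)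

/-- At stage `s` the block of `z` is found to belong to `K`, and `z` is not restrained. -/
def Enters (n z s : ℕ) : Prop :=
  (Code.evaln (s + 1) (ofNat Code (z / (2 * n))) (z / (2 * n))).isSome ∧
    Code.evaln s (ofNat Code (z / (2 * n))) (z / (2 * n)) = none ∧ ∀ d ∈ active n s, z ∉ petal d

/-- The `2n`-`d`-complete set that is not `n`-`d`-complete. -/
def setA (n : ℕ) : Set ℕ := {z | ∃ s, Enters n z s}

/-- The set of half-blocks that meet `setA`. -/
def setB (n : ℕ) : Set ℕ := {x | ∃ z ∈ Finset.Ico (n * x) (n * x + n), z ∈ setA n}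

/-- The auxiliary recursively enumerable set that does not reduce to `setA`. -/
def setC (n : ℕ) : Set ℕ :=
  {x | ∃ c, Acts n c ∧ wit₁ c = x ∧ ∀ z ∈ petal c, ∀ s < c + 1, ¬ Enters n z s}

/-! ### The construction is effective -/

theorem primrec_unpair₁ : Primrec fun x : ℕ => x.unpair.1 := Primrec.fst.comp Primrec.unpair

theorem primrec_unpair₂ : Primrec fun x : ℕ => x.unpair.2 := Primrec.snd.comp Primrec.unpair

theorem primrec_wit₁ : Primrec wit₁ := primrec_unpair₁

theorem primrec_wit₂ : Primrec wit₂ := primrec_unpair₁.comp primrec_unpair₂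

theorem primrec_steps : Primrec steps := primrec_unpair₂.comp primrec_unpair₂

theorem primrec_index : Primrec index := primrec_unpair₁.comp primrec_wit₁

theorem primrec_out : Primrec₂ out :=
  Code.primrec_evaln.comp (Primrec.pair (Primrec.pair Primrec.fst
    ((Primrec.ofNat Code).comp (primrec_unpair₁.comp Primrec.snd))) Primrec.snd)

theorem primrec_outList : Primrec₂ outList :=
  primrec_enumList.comp (Primrec.option_getD.comp primrec_out (Primrec.const 0))

theorem primrec_outList_wit₁ : Primrec fun c => outList (steps c) (wit₁ c) :=
  primrec_outList.comp primrec_steps primrec_wit₁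

theorem primrec_petal : Primrec petal := by
  classical
  have h : PrimrecRel fun (a : ℕ) (l : List ℕ) => a ∉ l := primrecRel_mem.not
  exact ((PrimrecRel.listFilter h).comp primrec_outList_wit₁
    (primrec_outList.comp primrec_steps primrec_wit₂)).of_eq fun c => by simp [petal]

theorem primrecPred_halts (n : ℕ) : PrimrecPred (Halts n) :=
  (primrecPred_isSome (primrec_out.comp primrec_steps primrec_wit₁)).and <|
    (primrecPred_isSome (primrec_out.comp primrec_steps primrec_wit₂)).and <|
    (Primrec.eq.comp (primrec_unpair₁.comp primrec_wit₂) primrec_index).and <|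
    (Primrec.eq.comp primrec_wit₁ primrec_wit₂).not.and <|
    Primrec.nat_le.comp (Primrec.list_length.comp primrec_outList_wit₁) (Primrec.const n)

theorem primrecRel_disjoint_blocks (b : ℕ) :
    PrimrecRel fun P Q : List ℕ => ∀ w ∈ P, ∀ z ∈ Q, z / b ≠ w / b := by
  have h : PrimrecRel fun z w : ℕ => z / b ≠ w / b :=
    (Primrec.eq.comp (Primrec.nat_div.comp Primrec.fst (Primrec.const b))
      (Primrec.nat_div.comp Primrec.snd (Primrec.const b))).not
  have h' : PrimrecRel fun (w : ℕ) (Q : List ℕ) => ∀ z ∈ Q, z / b ≠ w / b :=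
    h.forall_mem_list.comp Primrec.snd Primrec.fst
  exact h'.forall_mem_list

theorem primrecRel_compatible (n : ℕ) : PrimrecRel (Compatible n) := by
  have hi : Primrec fun p : ℕ × ℕ => index p.1 := primrec_index.comp Primrec.fst
  have hj : Primrec fun p : ℕ × ℕ => index p.2 := primrec_index.comp Primrec.snd
  exact (Primrec.eq.comp hi hj).not.and <| (Primrec.nat_le.comp hj hi).or <|
    (Primrec.nat_lt.comp Primrec.fst (primrec_wit₁.comp Primrec.snd)).and <|
    (Primrec.nat_lt.comp Primrec.fst (primrec_wit₂.comp Primrec.snd)).and <|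
    (primrecRel_disjoint_blocks (2 * n)).comp (primrec_petal.comp Primrec.fst)
      (primrec_petal.comp Primrec.snd)

theorem primrecRel_mayAct (n : ℕ) : PrimrecRel (MayAct n) :=
  ((primrecPred_halts n).comp Primrec.fst).and <|
    (primrecRel_compatible n).forall_mem_list.comp Primrec.snd Primrec.fst

theorem primrec_active (n : ℕ) : Primrec (active n) := by
  classical
  have hlt : PrimrecRel fun a c : ℕ => index a < index c :=
    Primrec.nat_lt.comp (primrec_index.comp Primrec.fst) (primrec_index.comp Primrec.snd)
  have hstep : Primrec₂ fun (c : ℕ) (L : List ℕ) =>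
      if MayAct n c L then c :: L.filter (index · < index c) else L :=
    Primrec.ite (primrecRel_mayAct n)
      (Primrec.list_cons.comp Primrec.fst (hlt.listFilter.comp Primrec.snd Primrec.fst))
      Primrec.snd
  refine (Primrec.nat_rec₁ [] hstep).of_eq fun s => ?_
  induction s with
  | zero => rfl
  | succ c ih =>
    simp only [active]
    rw [← ih]

theorem primrecPred_acts (n : ℕ) : PrimrecPred (Acts n) :=
  (primrecRel_mayAct n).comp Primrec.id (primrec_active n)

theorem primrecRel_enters (n : ℕ) : PrimrecRel (Enters n) := by
  have hb : Primrec fun p : ℕ × ℕ => p.1 / (2 * n) :=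
    Primrec.nat_div.comp Primrec.fst (Primrec.const _)
  have he {f : ℕ × ℕ → ℕ} (hf : Primrec f) : Primrec fun p : ℕ × ℕ =>
      Code.evaln (f p) (ofNat Code (p.1 / (2 * n))) (p.1 / (2 * n)) :=
    Code.primrec_evaln.comp (Primrec.pair (Primrec.pair hf ((Primrec.ofNat Code).comp hb)) hb)
  have hr : PrimrecRel fun d z : ℕ => z ∉ petal d :=
    (primrecRel_mem.comp Primrec.snd (primrec_petal.comp Primrec.fst)).not
  exact (primrecPred_isSome (he (Primrec.succ.comp Primrec.snd))).and <|
    (Primrec.eq.comp (he Primrec.snd) (Primrec.const none)).and <|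
    hr.forall_mem_list.comp ((primrec_active n).comp Primrec.snd) Primrec.fst

theorem isRE_setA (n : ℕ) : IsRE (setA n) := rePred_exists (primrecRel_enters n)

theorem isRE_setB (n : ℕ) (hn : 0 < n) : IsRE (setB n) := by
  -- Reducing modulo n keeps an unbounded search inside the half-block.
  have h : PrimrecRel fun x k : ℕ => Enters n (n * x + k.unpair.1 % n) k.unpair.2 :=
    (primrecRel_enters n).comp
      (Primrec.nat_add.comp (Primrec.nat_mul.comp (Primrec.const n) Primrec.fst)
        (Primrec.nat_mod.comp (primrec_unpair₁.comp Primrec.snd) (Primrec.const n)))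
      (primrec_unpair₂.comp Primrec.snd)
  refine (rePred_exists h).of_eq fun x => ?_
  constructor
  · rintro ⟨k, hk⟩
    have := Nat.mod_lt k.unpair.1 hn
    exact ⟨_, Finset.mem_Ico.2 ⟨by omega, by omega⟩, _, hk⟩
  · rintro ⟨z, hz, s, hs⟩
    rw [Finset.mem_Ico] at hz
    refine ⟨Nat.pair (z - n * x) s, ?_⟩
    rw [Nat.unpair_pair, Nat.mod_eq_of_lt (by omega)]
    rwa [Nat.add_sub_cancel' hz.1]

theorem isRE_setC (n : ℕ) : IsRE (setC n) := by
  have h1 : PrimrecRel fun s z : ℕ => ¬ Enters n z s :=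
    ((primrecRel_enters n).comp Primrec.snd Primrec.fst).not
  have h2 : PrimrecRel fun z c : ℕ => ∀ s < c + 1, ¬ Enters n z s :=
    h1.forall_lt.comp (Primrec.succ.comp Primrec.snd) Primrec.fst
  have h3 : PrimrecPred fun c : ℕ => ∀ z ∈ petal c, ∀ s < c + 1, ¬ Enters n z s :=
    h2.forall_mem_list.comp primrec_petal Primrec.id
  exact rePred_exists (p := fun x c => Acts n c ∧ wit₁ c = x ∧
    ∀ z ∈ petal c, ∀ s < c + 1, ¬ Enters n z s) <|
    ((primrecPred_acts n).comp Primrec.snd).and <|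
    (Primrec.eq.comp (primrec_wit₁.comp Primrec.snd) Primrec.fst).and <|
    h3.comp Primrec.snd

/-! ### Combinatorics of the construction -/

theorem active_succ_of_acts {n c : ℕ} (h : Acts n c) :
    active n (c + 1) = c :: (active n c).filter (index · < index c) := by
  exact if_pos h

theorem active_succ_of_not_acts {n c : ℕ} (h : ¬ Acts n c) : active n (c + 1) = active n c := by
  exact if_neg h

theorem mem_active_succ_of_acts {n c d : ℕ} (h : Acts n c) :
    d ∈ active n (c + 1) ↔ d = c ∨ (d ∈ active n c ∧ index d < index c) := by
  simp [active_succ_of_acts h]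

theorem mem_active_succ_cases {n c d : ℕ} (h : d ∈ active n (c + 1)) :
    (d = c ∧ Acts n c) ∨ d ∈ active n c := by
  by_cases hc : Acts n c
  · rw [mem_active_succ_of_acts hc] at h
    tauto
  · rw [active_succ_of_not_acts hc] at h
    exact Or.inr h

theorem lt_of_mem_active {n d : ℕ} : ∀ {s : ℕ}, d ∈ active n s → d < s
  | 0, h => by simp [active] at h
  | s + 1, h => by
    rcases mem_active_succ_cases h with ⟨rfl, -⟩ | h
    · exact Nat.lt_succ_self _
    · exact (lt_of_mem_active h).trans (Nat.lt_succ_self _)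

theorem acts_of_mem_active {n d : ℕ} : ∀ {s : ℕ}, d ∈ active n s → Acts n d
  | 0, h => by simp [active] at h
  | s + 1, h => by
    rcases mem_active_succ_cases h with ⟨rfl, h⟩ | h
    · exact h
    · exact acts_of_mem_active h

/-- A certificate can join the active list only at its own stage; once dropped it never returns. -/
theorem mem_active_of_le {n d s t : ℕ} (hds : d < s) (hst : s ≤ t) (h : d ∈ active n t) :
    d ∈ active n s := by
  induction t, hst using Nat.le_induction with
  | base => exact h
  | succ t hst ih =>
    rcases mem_active_succ_cases h with ⟨rfl, -⟩ | h
    · omega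
    · exact ih h

theorem mem_active_of_no_acts {n d s t : ℕ} (hst : s ≤ t)
    (hno : ∀ c, s ≤ c → Acts n c → index d < index c) (h : d ∈ active n s) : d ∈ active n t := by
  induction t, hst using Nat.le_induction with
  | base => exact h
  | succ t hst ih =>
    by_cases ht : Acts n t
    · exact (mem_active_succ_of_acts ht).2 (Or.inr ⟨ih, hno t hst ht⟩)
    · rwa [active_succ_of_not_acts ht]

/-- Each canceller has a smaller index than what it cancels, so the latest one in the chain starting
at c is still active. -/
theorem Acts.mem_active_or {n c s : ℕ} (h : Acts n c) (hcs : c < s) :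
    c ∈ active n s ∨ ∃ d ∈ active n s, c < d ∧ index d < index c := by
  induction s, (hcs : c + 1 ≤ s) using Nat.le_induction with
  | base => exact Or.inl ((mem_active_succ_of_acts h).2 (Or.inl rfl))
  | succ s hcs' ih =>
    by_cases hs : Acts n s
    · simp only [mem_active_succ_of_acts hs]
      rcases ih with hc | ⟨d, hd, hcd, hi⟩
      · by_cases hlt : index c < index s
        · exact Or.inl (Or.inr ⟨hc, hlt⟩)
        · have := (hs.2 c hc).1
          exact Or.inr ⟨s, Or.inl rfl, hcs', by omega⟩
      · by_cases hlt : index d < index s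
        · exact Or.inr ⟨d, Or.inr ⟨hd, hlt⟩, hcd, hi⟩
        · exact Or.inr ⟨s, Or.inl rfl, hcs', by omega⟩
    · rw [active_succ_of_not_acts hs]
      exact ih

/-- The certificates that survive an action have smaller index than the acting one, and against
those compatibility demands disjoint blocks. -/
theorem petal_disjoint_blocks {n : ℕ} : ∀ {s d e : ℕ}, d ∈ active n s → e ∈ active n s → d ≠ e →
    ∀ w ∈ petal d, ∀ z ∈ petal e, z / (2 * n) ≠ w / (2 * n)
  | 0, _, _, h, _, _ => by simp [active] at h
  | s + 1, d, e, hd, he, hde => by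
    intro w hw z hz
    by_cases hs : Acts n s
    · rw [mem_active_succ_of_acts hs] at hd he
      rcases hd with rfl | ⟨hd, hi⟩ <;> rcases he with rfl | ⟨he, hj⟩
      · exact absurd rfl hde
      · rcases (hs.2 e he).2 with h | ⟨-, -, h⟩
        · omega
        · exact (h z hz w hw).symm
      · rcases (hs.2 d hd).2 with h | ⟨-, -, h⟩
        · omega
        · exact h w hw z hz
      · exact petal_disjoint_blocks hd he hde w hw z hz
    · rw [active_succ_of_not_acts hs] at hd he
      exact petal_disjoint_blocks hd he hde w hw z hz

theorem Acts.length_petal_le {n d : ℕ} (h : Acts n d) : (petal d).length ≤ n :=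
  (List.length_filter_le _ _).trans h.1.2.2.2.2

/-- Every block contains an element that no active certificate restrains. -/
theorem exists_unrestrained {n : ℕ} (hn : 0 < n) (s e : ℕ) :
    ∃ z, z / (2 * n) = e ∧ ∀ d ∈ active n s, z ∉ petal d := by
  have hdiv {r : ℕ} (hr : r < 2 * n) : (2 * n * e + r) / (2 * n) = e := by
    rw [Nat.mul_add_div (by omega), Nat.div_eq_of_lt hr, add_zero]
  by_cases h : ∃ d ∈ active n s, ∃ w ∈ petal d, w / (2 * n) = e
  · obtain ⟨d, hd, w, hw, rfl⟩ := h
    obtain ⟨z, hz, hzd⟩ : ∃ z ∈ Finset.Ico (2 * n * (w / (2 * n))) (2 * n * (w / (2 * n)) + 2 * n),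
        z ∉ (petal d).toFinset := by
      -- The petal has at most n elements, the block `2 * n`.
      refine Finset.exists_mem_notMem_of_card_lt_card ?_
      have := (List.toFinset_card_le (petal d)).trans (acts_of_mem_active hd).length_petal_le
      rw [Nat.card_Ico]
      omega
    rw [Finset.mem_Ico] at hz
    have hze : z / (2 * n) = w / (2 * n) := by
      obtain ⟨r, rfl⟩ := Nat.exists_eq_add_of_le hz.1
      exact hdiv (by omega)
    refine ⟨z, hze, fun d' hd' hz' => ?_⟩
    by_cases hdd : d = d'
    · subst hdd
      exact hzd (by simpa using hz')
    · exact petal_disjoint_blocks hd hd' hdd w hw z hz' hze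
  · push Not at h
    exact ⟨2 * n * e, by simpa using hdiv (r := 0) (by omega),
      fun d hd hz => h d hd _ hz (by simpa using hdiv (r := 0) (by omega))⟩

/-! ### Reductions by blocks and half-blocks -/

theorem mem_K_of_mem_setA {n z : ℕ} (h : z ∈ setA n) : z / (2 * n) ∈ K := by
  obtain ⟨s, hs, -⟩ := h
  exact K_mem.2 ⟨_, hs⟩

theorem exists_mem_setA {n e : ℕ} (hn : 0 < n) (he : e ∈ K) : ∃ z, z / (2 * n) = e ∧ z ∈ setA n := by
  classical
  have hex := K_mem.1 he
  have hspec := Nat.find_spec hex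
  obtain ⟨s, hs⟩ : ∃ s, Nat.find hex = s + 1 := by
    refine Nat.exists_eq_succ_of_ne_zero fun h0 => ?_
    rw [h0] at hspec
    simp [Code.evaln] at hspec
  have hmin := Nat.find_min hex (m := s) (by omega)
  rw [hs] at hspec
  obtain ⟨z, rfl, hz⟩ := exists_unrestrained hn s e
  exact ⟨z, rfl, s, hspec, by simpa using hmin, hz⟩

theorem mem_K_iff_block {n : ℕ} (hn : 0 < n) (e : ℕ) :
    e ∈ K ↔ ∃ z ∈ Finset.Ico (2 * n * e) (2 * n * e + 2 * n), z ∈ setA n := by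
  constructor
  · intro he
    obtain ⟨z, rfl, hz⟩ := exists_mem_setA hn he
    refine ⟨z, Finset.mem_Ico.2 ⟨Nat.mul_div_le _ _, Nat.lt_mul_div_succ _ (by omega)⟩, hz⟩
  · rintro ⟨z, hz, hA⟩
    rw [Finset.mem_Ico] at hz
    obtain ⟨r, rfl⟩ := Nat.exists_eq_add_of_le hz.1
    have := mem_K_of_mem_setA hA
    rwa [Nat.mul_add_div (by omega), Nat.div_eq_of_lt (by omega), add_zero] at this

theorem dCompleteVia_setA {n : ℕ} (hn : 0 < n) :
    DCompleteVia (setA n) fun e => Finset.Ico (2 * n * e) (2 * n * e + 2 * n) :=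
  ⟨isRE_setA n, computable_Ico_mul _ (by omega), mem_K_iff_block hn⟩

theorem reduces_setB_setA {n : ℕ} (hn : 0 < n) : Reduces n (setB n) (setA n) :=
  ⟨fun x => Finset.Ico (n * x) (n * x + n), computable_Ico_mul n hn, fun x => by simp,
    fun _ => Iff.rfl⟩

theorem reduces_K_setB {n : ℕ} (hn : 0 < n) : Reduces 2 K (setB n) := by
  refine ⟨fun e => Finset.Ico (2 * e) (2 * e + 2), computable_Ico_mul 2 (by omega),
    fun x => by simp, fun e => (mem_K_iff_block hn e).trans ?_⟩
  simp only [setB, Set.mem_ofPred_eq, Finset.mem_Ico]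
  have h1 : n * (2 * e) = 2 * n * e := by ring
  have h2 : n * (2 * e + 1) = 2 * n * e + n := by ring
  constructor
  · rintro ⟨z, hz, hA⟩
    by_cases h : z < 2 * n * e + n
    · exact ⟨2 * e, by omega, z, by omega, hA⟩
    · exact ⟨2 * e + 1, by omega, z, by omega, hA⟩
  · rintro ⟨x, hx, z, hz, hA⟩
    obtain rfl | rfl : x = 2 * e ∨ x = 2 * e + 1 := by omega
    · exact ⟨z, by omega, hA⟩
    · exact ⟨z, by omega, hA⟩

/-! ### Diagonalization -/

/-- Each requirement acts only finitely often. -/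
theorem exists_forall_acts_le_index (n i : ℕ) : ∃ s, ∀ c, s ≤ c → Acts n c → i ≤ index c := by
  induction i with
  | zero => exact ⟨0, fun _ _ _ => Nat.zero_le _⟩
  | succ i ih =>
    obtain ⟨s, hs⟩ := ih
    by_cases h : ∃ c, s ≤ c ∧ Acts n c ∧ index c = i
    · obtain ⟨c₀, hc₀, hact, hi⟩ := h
      -- No smaller index acts any more, so `c₀` is never dropped, and while active it blocks every
      -- certificate of its own index.
      have key (t : ℕ) (ht : c₀ + 1 ≤ t) : c₀ ∈ active n t := by
        induction t, ht using Nat.le_induction with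
        | base => exact (mem_active_succ_of_acts hact).2 (Or.inl rfl)
        | succ t ht ih =>
          by_cases h : Acts n t
          · have h1 := hs t (by omega) h
            have h2 := (h.2 c₀ ih).1
            exact (mem_active_succ_of_acts h).2 (Or.inr ⟨ih, by omega⟩)
          · rwa [active_succ_of_not_acts h]
      refine ⟨c₀ + 1, fun c hc h => ?_⟩
      have h1 := hs c (by omega) h
      have h2 := (h.2 c₀ (key c hc)).1
      omega
    · push Not at h
      refine ⟨s, fun c hc hact => ?_⟩
      have h1 := hs c hc hact
      have h2 := h c hc hact
      omega

theorem wit₁_le (c : ℕ) : wit₁ c ≤ c := Nat.unpair_left_le c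

/-- The witnesses of a permanently active certificate are used by no other certificate. -/
theorem Acts.eq_of_wit₁ {n c d : ℕ} (hd : Acts n d) (hstay : ∀ s, d < s → d ∈ active n s)
    (hc : Acts n c) (h : wit₁ c = wit₁ d ∨ wit₁ c = wit₂ d) : c = d := by
  have hidx : index c = index d := by
    rcases h with h | h
    · rw [index, h]; rfl
    · rw [index, h]; exact hd.1.2.2.1
  rcases lt_trichotomy c d with hlt | heq | hgt
  · exfalso
    -- If c was dropped, a later `d'` of higher priority is active when d acts, so the witnesses of
    -- d exceed `d'`, hence c, hence `wit₁ c`.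
    rcases hc.mem_active_or hlt with h' | ⟨d', hd', hcd, hi⟩
    · exact (hd.2 c h').1 hidx
    · have := wit₁_le c
      rcases (hd.2 d' hd').2 with h' | ⟨h1, h2, -⟩
      · omega
      · rcases h with h | h <;> omega
  · exact heq
  · exact absurd hidx.symm (hc.2 d (hstay c hgt)).1

/-- If a permanently active certificate puts its first witness into `setC`, then its petal is
disjoint from `setA`. -/
theorem notMem_setA_of_mem_petal {n d z : ℕ} (hstay : ∀ s, d < s → d ∈ active n s)
    (h : ∀ z ∈ petal d, ∀ s < d + 1, ¬ Enters n z s) (hz : z ∈ petal d) : z ∉ setA n := by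
  rintro ⟨s, hs⟩
  by_cases hsd : s < d + 1
  · exact h z hz s hsd hs
  · exact hs.2.2 d (hstay s (by omega)) hz

theorem not_reduces_setC (n : ℕ) : ¬ Reduces n (setC n) (setA n) := by
  rintro ⟨f, hf, hcard, hred⟩
  have hp : Nat.Partrec fun x => Part.some (Primcodable.toEncodable.encode (f x)) :=
    Partrec.nat_iff.1 (Computable.encode.comp hf)
  obtain ⟨code, hcode⟩ := Code.exists_code.1 hp
  obtain ⟨i, rfl⟩ : ∃ i, code = ofNat Code i := ⟨encode code, by simp⟩
  have hout {t x : ℕ} (hx : x.unpair.1 = i) (h : (out t x).isSome) :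
      out t x = some (Primcodable.toEncodable.encode (f x)) := by
    obtain ⟨y, hy⟩ := Option.isSome_iff_exists.1 h
    have hy' : y ∈ Code.evaln t (ofNat Code i) x := by rw [← hx]; exact hy
    have := Code.evaln_sound hy'
    rw [hcode] at this
    rw [hy, Part.mem_some_iff.1 this]
  have hlist {t x : ℕ} (hx : x.unpair.1 = i) (h : (out t x).isSome) :
      outList t x = enumList (Primcodable.toEncodable.encode (f x)) := by
    rw [outList, hout hx h]; rfl
  have hhalt (x : ℕ) (hx : x.unpair.1 = i) : ∃ t₀, ∀ t, t₀ ≤ t → (out t x).isSome := by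
    have : Primcodable.toEncodable.encode (f x) ∈ Code.eval (ofNat Code i) x := by
      rw [hcode]; exact Part.mem_some _
    obtain ⟨t₀, ht₀⟩ := Code.evaln_complete.1 this
    refine ⟨t₀, fun t ht => ?_⟩
    have := Code.evaln_mono ht ht₀
    rw [out, hx, Option.isSome_iff_exists]
    exact ⟨_, this⟩
  obtain ⟨s₀, hs₀⟩ := exists_forall_acts_le_index n (i + 1)
  by_cases hd : ∃ d ∈ active n s₀, index d = i
  · obtain ⟨d, hd, hi⟩ := hd
    have hact := acts_of_mem_active hd
    have hstay (s : ℕ) (hs : d < s) : d ∈ active n s := by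
      rcases le_total s s₀ with h | h
      · exact mem_active_of_le hs h hd
      · exact mem_active_of_no_acts h (fun c hc hc' => by have := hs₀ c hc hc'; omega) hd
    obtain ⟨h1, h2, h3, hne, -⟩ := hact.1
    have hpetal (z : ℕ) : z ∈ petal d ↔ z ∈ f (wit₁ d) ∧ z ∉ f (wit₂ d) := by
      simp [petal, hlist hi h1, hlist (h3.trans hi) h2, mem_enumList_encode]
    -- This decides whether `wit₁ d` enters C: either the restraint came in time, or the petal had
    -- already met A.
    by_cases hP : ∀ z ∈ petal d, ∀ s < d + 1, ¬ Enters n z s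
    · obtain ⟨z, hz, hA⟩ := (hred (wit₁ d)).1 ⟨d, hact, rfl, hP⟩
      have hz2 : z ∈ f (wit₂ d) := by
        by_contra hz2
        exact notMem_setA_of_mem_petal hstay hP ((hpetal z).2 ⟨hz, hz2⟩) hA
      obtain ⟨c, hc, hcw, -⟩ := (hred (wit₂ d)).2 ⟨z, hz2, hA⟩
      obtain rfl := hact.eq_of_wit₁ hstay hc (Or.inr hcw)
      exact hne hcw
    · push Not at hP
      obtain ⟨z, hz, s, hs, hE⟩ := hP
      obtain ⟨c, hc, hcw, hcP⟩ := (hred (wit₁ d)).2 ⟨z, ((hpetal z).1 hz).1, s, hE⟩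
      obtain rfl := hact.eq_of_wit₁ hstay hc (Or.inl hcw)
      exact hcP z hz s hs hE
  · push Not at hd
    classical
    -- T is the union of all blocks touched by active petals. Two witnesses whose f-values agree on
    -- T give a petal disjoint from T.
    let T : Finset ℕ := (active n s₀).toFinset.biUnion fun d =>
      (petal d).toFinset.biUnion fun w =>
        Finset.Ico (2 * n * (w / (2 * n))) (2 * n * (w / (2 * n)) + 2 * n)
    -- The shift makes the witnesses exceed every certificate active at `s₀`.
    let x (k : ℕ) : ℕ := Nat.pair i (s₀ + k)
    have hx (k : ℕ) : (x k).unpair.1 = i := by simp [x]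
    have hxs (k : ℕ) : s₀ ≤ x k := (Nat.le_add_right _ _).trans (Nat.right_le_pair _ _)
    obtain ⟨k, -, l, -, hkl, hT⟩ := Set.infinite_univ.exists_ne_map_eq_of_mapsTo
      (f := fun k => f (x k) ∩ T) (t := (T.powerset : Set (Finset ℕ)))
      (fun k _ => by simp) (Finset.finite_toSet _)
    obtain ⟨t₁, ht₁⟩ := hhalt (x k) (hx k)
    obtain ⟨t₂, ht₂⟩ := hhalt (x l) (hx l)
    obtain ⟨t, h1, h2, h0⟩ : ∃ t, t₁ ≤ t ∧ t₂ ≤ t ∧ s₀ ≤ t :=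
      ⟨t₁ + t₂ + s₀, by omega, by omega, by omega⟩
    obtain ⟨c, hc1, hc2, hct⟩ : ∃ c, wit₁ c = x k ∧ wit₂ c = x l ∧ steps c = t :=
      ⟨Nat.pair (x k) (Nat.pair (x l) t), by simp [wit₁], by simp [wit₂], by simp [steps]⟩
    have hci : index c = i := by rw [index, hc1, hx]
    have hcs : s₀ ≤ c := by
      have := wit₁_le c
      have := hxs k
      omega
    have hact : Acts n c := by
      refine ⟨⟨?_, ?_, ?_, ?_, ?_⟩, fun d hd' => ?_⟩
      · rw [hct, hc1]; exact ht₁ t h1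
      · rw [hct, hc2]; exact ht₂ t h2
      · rw [hc2, hx, hci]
      · rw [hc1, hc2]
        intro h
        apply hkl
        have := congrArg (fun y => y.unpair.2) h
        simpa [x] using this
      · rw [hct, hc1, hlist (hx k) (ht₁ t h1), length_enumList_encode]
        exact hcard _
      · by_cases hds : d < s₀
        · have hd₀ := mem_active_of_le hds hcs hd'
          refine ⟨by rw [hci]; exact hd d hd₀, Or.inr ⟨?_, ?_, fun w hw z hz hzw => ?_⟩⟩
          · rw [hc1]; exact hds.trans_le (hxs k)
          · rw [hc2]; exact hds.trans_le (hxs l)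
          · simp only [petal, hct, hc1, hc2, hlist (hx k) (ht₁ t h1), hlist (hx l) (ht₂ t h2),
              List.mem_filter, mem_enumList_encode, decide_eq_true_eq] at hz
            -- For n = 0 blocks are degenerate, but then f takes only the empty value.
            by_cases hn : n = 0
            · have := hcard (x k)
              rw [hn, Nat.le_zero, Finset.card_eq_zero] at this
              simp [this] at hz
            have hzT : z ∈ T := by
              simp only [T, Finset.mem_biUnion, List.mem_toFinset]
              refine ⟨d, hd₀, w, hw, ?_⟩
              rw [← hzw, Finset.mem_Ico]
              exact ⟨Nat.mul_div_le _ _, Nat.lt_mul_div_succ _ (by omega)⟩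
            have : z ∈ f (x k) ∩ T := Finset.mem_inter.2 ⟨hz.1, hzT⟩
            rw [show f (x k) ∩ T = f (x l) ∩ T from hT] at this
            exact hz.2 (Finset.mem_inter.1 this).1
        · have := hs₀ d (by omega) (acts_of_mem_active hd')
          exact ⟨by omega, Or.inl (by omega)⟩
    have := hs₀ c hcs hact
    omega

theorem not_reduces_K_setA (n : ℕ) : ¬ Reduces n K (setA n) := by
  rintro ⟨f, hf, hcard, hred⟩
  obtain ⟨h, hh, hhC⟩ := (isRE_setC n).exists_reduction_K
  exact not_reduces_setC n ⟨fun x => f (h x), hf.comp hh, fun x => hcard _,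
    fun x => (hhC x).trans (hred _)⟩

end ND

theorem mainTheorem6 (n : ℕ) (hn : 2 ≤ n) :
    (¬ ∀ A B C : {S : Set ℕ // ND.IsRE S},
        ND.reduction n A B → ND.reduction n B C → ND.reduction n A C) ∧
    ∃ A B : Set ℕ, ND.IsRE A ∧ ND.IsRE B ∧ ND.NDComplete (2 * n) A ∧ ¬ ND.NDComplete n A ∧
      ND.Reduces n ND.K B ∧ ND.Reduces n B A ∧ ¬ ND.Reduces n ND.K A := by
  have hpos : 0 < n := by omega
  have hKB : ND.Reduces n ND.K (ND.setB n) := by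
    obtain ⟨f, hf, hcard, hred⟩ := ND.reduces_K_setB hpos
    -- The two half-blocks of a block are where n ≥ 2 is needed.
    exact ⟨f, hf, fun e => (hcard e).trans hn, hred⟩
  refine ⟨fun h => ND.not_reduces_K_setA n (h ⟨_, ND.isRE_K⟩ ⟨_, ND.isRE_setB n hpos⟩
    ⟨_, ND.isRE_setA n⟩ hKB (ND.reduces_setB_setA hpos)), ND.setA n, ND.setB n, ND.isRE_setA n,
    ND.isRE_setB n hpos, ⟨_, ND.dCompleteVia_setA hpos, fun e => by simp⟩, ?_, hKB,
    ND.reduces_setB_setA hpos, ND.not_reduces_K_setA n⟩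
  rintro ⟨f, ⟨-, hf, hred⟩, hcard⟩
  exact ND.not_reduces_K_setA n ⟨f, hf, hcard, hred⟩
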